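/- Let $H$ be a real Hilbert space, let $L:D(L)\subset H\to H$ be a densely defined linear operator with $L=L^*\ge 0$, and let $g:H\to H$ be a $C^2_{loc}$ map, i.e. $g$ is twice Fréchet differentiable on $H$ and every point of $H$ is the centre of a closed ball on which $g$, $g'$ and $g''$ are bounded. Assume $(g'(u)h,h)\ge 0$ for all $u,h\in H$, and assume that the equation $$Lv+g(v)=0,\qquad v\in D(L),\tag{1}$$ has at least one solution. Then the set of solutions of (1) is closed and convex, and (1) has a unique solution $v$ of minimal norm. Let $u_0\in H$. For every $\varepsilon>0$ the operator $L+\varepsilon I$ has a bounded inverse defined on all of $H$, the operator $I+(L+\varepsilon I)^{-1}g'(u)$ is boundedly invertible for every $u\in H$, and, with $$\Phi_\varepsilon(u)=-[I+(L+\varepsilon I)^{-1}g'(u)]^{-1}[u+(L+\varepsilon I)^{-1}g(u)],$$ the Cauchy problem $\dot u=\Phi_\varepsilon(u)$, $u(0)=u_0$, has a unique global solution $u_\varepsilon(t)$, $t\ge 0$; the limit $v_\varepsilon:=\lim_{t\to\infty}u_\varepsilon(t)$ exists in $H$, $v_\varepsilon\in D(L)$, and $$Lv_\varepsilon+\varepsilon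 v_\varepsilon+g(v_\varepsilon)=0.$$ Moreover, $\lim_{\varepsilon\to 0^+}v_\varepsilon=v$ in the norm of $H$. -/

import Mathlib

open Set Filter Topology
open scoped InnerProductSpace

namespace DSM

variable {H : Type*} [NormedAddCommGroup H] [InnerProductSpace ℝ H]

/-- `g` is of class `C²_loc` on `H`: it is twice Fréchet differentiable, and every point is the
centre of a closed ball on which `g`, `g'` and `g''` are bounded. -/
structure IsC2Loc (g : H → H) : Prop where
  differentiable : Differentiable ℝ g
  differentiable_fderiv : Differentiable ℝ (fderiv ℝ g)
  locally_bounded : ∀ u₀ : H, ∃ R : ℝ, 0 < R ∧ ∃ m₀ m₁ m₂ : ℝ, ∀ u ∈ Metric.closedBall u₀ R,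
    ‖g u‖ ≤ m₀ ∧ ‖fderiv ℝ g u‖ ≤ m₁ ∧ ‖fderiv ℝ (fderiv ℝ g) u‖ ≤ m₂

/-- The operator `L + ε I`, with the same domain as `L`. -/
def shift (L : H →ₗ.[ℝ] H) (ε : ℝ) : H →ₗ.[ℝ] H :=
  (ε • (LinearMap.id : H →ₗ[ℝ] H)) +ᵥ L

/-- The set of solutions `v ∈ D(A)` of `A v + g v = 0`. -/
def solutionSet (A : H →ₗ.[ℝ] H) (g : H → H) : Set H :=
  {v | ∃ hv : v ∈ A.domain, A ⟨v, hv⟩ + g v = 0}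

/-- `v` is a solution of `A v + g v = 0` of minimal norm. -/
def IsMinNormSolution (A : H →ₗ.[ℝ] H) (g : H → H) (v : H) : Prop :=
  v ∈ solutionSet A g ∧ ∀ w ∈ solutionSet A g, ‖v‖ ≤ ‖w‖

/-- The bounded operator `T`, defined on all of `H`, is the two-sided inverse of `A`. -/
def IsBoundedInverse (A : H →ₗ.[ℝ] H) (T : H →L[ℝ] H) : Prop :=
  (∀ y : H, ∃ h : T y ∈ A.domain, A ⟨T y, h⟩ = y) ∧ ∀ x : A.domain, T (A x) = x

/-- The operator `I + T g'(u)`, where `T` stands for the inverse of the linear part. -/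
noncomputable def newtonOp (T : H →L[ℝ] H) (g : H → H) (u : H) : H →L[ℝ] H :=
  ContinuousLinearMap.id ℝ H + T.comp (fderiv ℝ g u)

/-- `Φ(u) = -[I + T g'(u)]⁻¹ [u + T g(u)]`. -/
noncomputable def field (T : H →L[ℝ] H) (g : H → H) (u : H) : H :=
  -((newtonOp T g u).inverse (u + T (g u)))

/-- `u` solves `u' = Φ(u)` on `[0, ∞)` with `u(0) = u₀`; the derivative at `0` is one-sided. -/
def IsGlobalSolution (Φ : H → H) (u₀ : H) (u : ℝ → H) : Prop :=
  u 0 = u₀ ∧ ∀ t : ℝ, 0 ≤ t → HasDerivWithinAt u (Φ (u t)) (Ici 0) t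

end DSM

namespace DSM

/-! ### Cauchy criterion along a filter, serving both sequences and `ε → 0⁺`. -/

section Metric

variable {X ι : Type*} [MetricSpace X]

/-! Put `T = (L + ε)⁻¹` and `F u = u + T (g u)`; zeros of `F` solve the regularized equation. Only
`ε ‖T x‖² ≤ ⟪T x, x⟫`, injectivity of `T` and monotonicity of `g` make `F` a homeomorphism of `H`
with invertible derivative (`exists_homeomorph_add_comp`). Since `Φ = -F'⁻¹ F`, the flow satisfies
`(F u)' = -F u`, so `u t = F⁻¹ (exp (-t) • F u₀)`: it is global, unique and tends to `F⁻¹ 0`. As `ε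
→ 0⁺`, monotonicity makes `‖v_ε‖` increase while staying below the norm of every solution, and `‖v_ε
- v_δ‖²` is at most the gap between the squared norms (`dist_sq_le_of_mem_solutionSet`). Hence `v_ε`
converges, and closedness of `L` makes the limit a solution. -/

theorem exists_tendsto_of_dist_le [CompleteSpace X] {l : Filter ι} [l.NeBot] {x : ι → X} {b : ι × ι → ℝ}
    (hb : Tendsto b (l ×ˢ l) (𝓝 0)) (h : ∀ᶠ p in l ×ˢ l, dist (x p.1) (x p.2) ≤ b p) :
    ∃ a, Tendsto x l (𝓝 a) := by
  have hc : Cauchy (map x l) := by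
    rw [cauchy_map_iff]
    refine ⟨inferInstance, tendsto_uniformity_iff_dist_tendsto_zero.2 ?_⟩
    exact squeeze_zero' (Eventually.of_forall fun _ => dist_nonneg) h hb
  exact CompleteSpace.complete hc

theorem _root_.Filter.Tendsto.dist_prod_self {l : Filter ι} {y : ι → X} {a : X}
    (h : Tendsto y l (𝓝 a)) : Tendsto (fun p : ι × ι => dist (y p.1) (y p.2)) (l ×ˢ l) (𝓝 0) := by
  simpa using (h.comp tendsto_fst).dist (h.comp tendsto_snd)

end Metric

variable {H : Type*} [NormedAddCommGroup H] [InnerProductSpace ℝ H]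

/-! ### Monotone maps -/

/-- A differentiable map whose derivative is everywhere nonnegative is monotone. -/
theorem inner_sub_sub_nonneg {g : H → H} (hd : Differentiable ℝ g)
    (hmono : ∀ u h : H, 0 ≤ ⟪fderiv ℝ g u h, h⟫_ℝ) (a b : H) : 0 ≤ ⟪g a - g b, a - b⟫_ℝ := by
  have hder : ∀ t : ℝ, HasDerivAt (fun t : ℝ => ⟪g (b + t • (a - b)), a - b⟫_ℝ)
      ⟪fderiv ℝ g (b + t • (a - b)) (a - b), a - b⟫_ℝ t := by
    intro t
    have h1 : HasDerivAt (fun t : ℝ => b + t • (a - b)) (a - b) t := by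
      simpa using ((hasDerivAt_id t).smul_const (a - b)).const_add b
    have h2 := (hd (b + t • (a - b))).hasFDerivAt.comp_hasDerivAt t h1
    simpa using h2.inner ℝ (hasDerivAt_const t (a - b))
  have hm := monotone_of_hasDerivAt_nonneg hder (fun t => hmono _ _) zero_le_one
  simp only [zero_smul, add_zero, one_smul, add_sub_cancel] at hm
  rw [inner_sub_left]
  linarith

/-! ### The map `u ↦ u + T g(u)` for a coercive `T` -/

/-- If `⟪T p, p⟫ ≥ ε ‖T p‖²` and `⟪p, d⟫ ≥ 0`, then `T p` is controlled by `d + T p`. -/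
theorem mul_norm_sq_le_inner {T : H →L[ℝ] H} {ε : ℝ}
    (hT : ∀ x, ε * ‖T x‖ ^ 2 ≤ ⟪T x, x⟫_ℝ) {p d : H} (hpd : 0 ≤ ⟪p, d⟫_ℝ) :
    ε * ‖T p‖ ^ 2 ≤ ⟪p, d + T p⟫_ℝ := by
  rw [inner_add_right, real_inner_comm (T p) p]
  linarith [hT p]

theorem injective_add_comp {T : H →L[ℝ] H} {ε : ℝ} (hε : 0 < ε)
    (hT : ∀ x, ε * ‖T x‖ ^ 2 ≤ ⟪T x, x⟫_ℝ) {g : H → H}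
    (hg : ∀ a b, 0 ≤ ⟪g a - g b, a - b⟫_ℝ) : Function.Injective fun u => u + T (g u) := by
  intro a b hab
  have h0 : (a - b) + T (g a - g b) = 0 := by
    have hab' : a + T (g a) = b + T (g b) := hab
    rw [map_sub, ← sub_eq_zero.2 hab']
    abel
  have h1 := mul_norm_sq_le_inner hT (hg a b)
  rw [h0, inner_zero_right] at h1
  have h2 : T (g a - g b) = 0 := by
    have : ‖T (g a - g b)‖ ^ 2 ≤ 0 := by nlinarith [sq_nonneg ‖T (g a - g b)‖]
    simpa using le_antisymm this (sq_nonneg _)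
  rw [h2, add_zero] at h0
  exact sub_eq_zero.1 h0

/-- Coercivity bounds `N` below, giving injectivity and closed range; the range is dense because
only `0` is orthogonal to it. Neither `T` nor `B` need be symmetric. -/
theorem isInvertible_id_add_comp [CompleteSpace H] {T : H →L[ℝ] H} {ε : ℝ} (hε : 0 < ε)
    (hT : ∀ x, ε * ‖T x‖ ^ 2 ≤ ⟪T x, x⟫_ℝ) (hTinj : Function.Injective T) {B : H →L[ℝ] H}
    (hB : ∀ h, 0 ≤ ⟪B h, h⟫_ℝ) : (ContinuousLinearMap.id ℝ H + T.comp B).IsInvertible := by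
  set N : H →L[ℝ] H := ContinuousLinearMap.id ℝ H + T.comp B with hN
  have hNa : ∀ h, N h = h + T (B h) := fun h => by simp [hN]
  have hbound : ∀ h, ‖h‖ ≤ (1 + ‖B‖ / ε) * ‖N h‖ := by
    intro h
    have h1 : ε * ‖T (B h)‖ ^ 2 ≤ ‖B‖ * ‖N h‖ * ‖T (B h)‖ := by
      have e1 : B h = B (N h) - B (T (B h)) := by rw [← map_sub, hNa]; simp
      have e2 : ⟪T (B h), B h⟫_ℝ = ⟪B (N h), T (B h)⟫_ℝ - ⟪B (T (B h)), T (B h)⟫_ℝ := by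
        rw [← inner_sub_left, ← e1, real_inner_comm]
      have e3 : ⟪B (N h), T (B h)⟫_ℝ ≤ ‖B‖ * ‖N h‖ * ‖T (B h)‖ :=
        (real_inner_le_norm _ _).trans (by gcongr; exact B.le_opNorm _)
      linarith [hT (B h), hB (T (B h))]
    have h2 : ‖T (B h)‖ ≤ ‖B‖ / ε * ‖N h‖ := by
      rcases eq_or_lt_of_le (norm_nonneg (T (B h))) with h0 | h0
      · rw [← h0]; positivity
      · have : ε * ‖T (B h)‖ ≤ ‖B‖ * ‖N h‖ := by
          refine le_of_mul_le_mul_right ?_ h0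
          calc ε * ‖T (B h)‖ * ‖T (B h)‖ = ε * ‖T (B h)‖ ^ 2 := by ring
            _ ≤ _ := h1
        rw [div_mul_eq_mul_div, le_div_iff₀ hε]
        linarith
    calc ‖h‖ = ‖N h - T (B h)‖ := by rw [hNa]; simp
      _ ≤ ‖N h‖ + ‖T (B h)‖ := norm_sub_le _ _
      _ ≤ _ := by linarith
  have hanti : AntilipschitzWith (1 + ‖B‖ / ε).toNNReal N := by
    refine AddMonoidHomClass.antilipschitz_of_bound N fun h => ?_
    rw [Real.coe_toNNReal _ (by positivity)]
    exact hbound h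
  have hker : (N : H →ₗ[ℝ] H).ker = ⊥ := LinearMap.ker_eq_bot.2 hanti.injective
  have hclosed : IsClosed ((N : H →ₗ[ℝ] H).range : Set H) :=
    hanti.isClosed_range N.uniformContinuous
  have hrange : (N : H →ₗ[ℝ] H).range = ⊤ := by
    rw [← hclosed.submodule_topologicalClosure_eq, Submodule.topologicalClosure_eq_top_iff,
      Submodule.eq_bot_iff]
    intro x hx
    have hx' : ∀ h, ⟪N h, x⟫_ℝ = 0 := fun h => (Submodule.mem_orthogonal _ _).1 hx _ ⟨h, rfl⟩
    -- At `h = T* x` the relation reads `⟪T x, x⟫ + ⟪B T* x, T* x⟫ = 0`, with both terms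
    -- nonnegative.
    have e := hx' (ContinuousLinearMap.adjoint T x)
    rw [hNa, inner_add_left, ContinuousLinearMap.adjoint_inner_left,
      ← ContinuousLinearMap.adjoint_inner_right, real_inner_comm] at e
    have h1 := hB (ContinuousLinearMap.adjoint T x)
    have h2 := hT x
    have h3 : T x = 0 := by
      have : ‖T x‖ ^ 2 ≤ 0 := by nlinarith [sq_nonneg ‖T x‖]
      simpa using le_antisymm this (sq_nonneg _)
    exact hTinj (h3.trans (map_zero T).symm)
  exact ⟨ContinuousLinearEquiv.ofBijective N hker hrange, rfl⟩

/-- Near every point of the target, the values of `g` are bounded on the preimage under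
`u ↦ u + T g(u)`. -/
theorem exists_norm_le_of_dist_le {T : H →L[ℝ] H} {ε : ℝ} (hε : 0 < ε)
    (hT : ∀ x, ε * ‖T x‖ ^ 2 ≤ ⟪T x, x⟫_ℝ) {g : H → H}
    (hg : ∀ a b, 0 ≤ ⟪g a - g b, a - b⟫_ℝ)
    (hloc : ∀ y : H, ∃ R : ℝ, 0 < R ∧ ∃ m : ℝ, ∀ u ∈ Metric.closedBall y R, ‖g u‖ ≤ m) (y : H) :
    ∃ r > 0, ∃ C, ∀ u, ‖u + T (g u) - y‖ ≤ r → ‖g u‖ ≤ C := by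
  obtain ⟨R, hR, m, hm⟩ := hloc y
  have hm0 : 0 ≤ m := (norm_nonneg _).trans (hm y (Metric.mem_closedBall_self hR.le))
  refine ⟨R / 2, by positivity, (2 * R * m + m ^ 2 / (4 * ε)) / (R / 2), fun u hu => ?_⟩
  rw [le_div_iff₀ (by positivity)]
  rcases eq_or_ne (g u) 0 with h0 | h0
  · rw [h0, norm_zero, zero_mul]; positivity
  set p := g u with hp
  have hpn : 0 < ‖p‖ := norm_pos_iff.2 h0
  -- Monotonicity is applied between `u` and `y + R • e`: this direction costs `R ‖p‖`, while `d`
  -- returns at most `(R / 2) ‖p‖`, so `(R / 2) ‖p‖` remains to be bounded.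
  set e : H := ‖p‖⁻¹ • p with he
  have hen : ‖e‖ = 1 := by rw [he, norm_smul, norm_inv, norm_norm, inv_mul_cancel₀ hpn.ne']
  have hpe : ⟪p, e⟫_ℝ = ‖p‖ := by
    rw [he, inner_smul_right, real_inner_self_eq_norm_sq]
    field_simp
  have hgz : ‖g (y + R • e)‖ ≤ m := by
    apply hm
    simp [norm_smul, hen, abs_of_pos hR]
  set d := u + T p - y with hd
  have hu' : u - (y + R • e) = d - T p - R • e := by rw [hd]; abel
  have h1 := hg u (y + R • e)
  rw [inner_sub_left, hu', ← hp] at h1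
  have h2 : ⟪p, d - T p - R • e⟫_ℝ ≤ ‖p‖ * (R / 2) - ε * ‖T p‖ ^ 2 - R * ‖p‖ := by
    rw [inner_sub_right, inner_sub_right, inner_smul_right, hpe, real_inner_comm (T p) p]
    have : ⟪p, d⟫_ℝ ≤ ‖p‖ * (R / 2) := (real_inner_le_norm _ _).trans (by gcongr)
    linarith [hT p]
  have h3 : -⟪g (y + R • e), d - T p - R • e⟫_ℝ ≤ m * (R / 2 + ‖T p‖ + R) := by
    refine (neg_le_abs _).trans ((abs_real_inner_le_norm _ _).trans ?_)
    gcongr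
    calc ‖d - T p - R • e‖ ≤ ‖d‖ + ‖T p‖ + ‖R • e‖ :=
          (norm_sub_le _ _).trans (by gcongr; exact norm_sub_le _ _)
      _ ≤ _ := by
        rw [norm_smul, hen, Real.norm_of_nonneg hR.le]
        linarith
  -- Young's inequality, so that the coercive term absorbs `m ‖T p‖`.
  have h4 : m * ‖T p‖ ≤ ε * ‖T p‖ ^ 2 + m ^ 2 / (4 * ε) := by
    have : 0 ≤ (2 * ε * ‖T p‖ - m) ^ 2 / (4 * ε) := by positivity
    have e : (2 * ε * ‖T p‖ - m) ^ 2 / (4 * ε)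
        = ε * ‖T p‖ ^ 2 + m ^ 2 / (4 * ε) - m * ‖T p‖ := by
      field_simp; ring
    linarith
  have h5 : 0 ≤ R * m := by positivity
  linarith

/-- If the images `z n` converge, the values `g (u n)` are eventually bounded by `C`, so coercivity
gives `ε ‖T (g (u n) - g (u k))‖² ≤ 2 C ‖z n - z k‖` and `u` is Cauchy. -/
theorem isClosed_range_add_comp [CompleteSpace H] {T : H →L[ℝ] H} {ε : ℝ} (hε : 0 < ε)
    (hT : ∀ x, ε * ‖T x‖ ^ 2 ≤ ⟪T x, x⟫_ℝ) {g : H → H} (hc : Continuous g)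
    (hg : ∀ a b, 0 ≤ ⟪g a - g b, a - b⟫_ℝ)
    (hloc : ∀ y : H, ∃ R : ℝ, 0 < R ∧ ∃ m : ℝ, ∀ u ∈ Metric.closedBall y R, ‖g u‖ ≤ m) :
    IsClosed (range fun u => u + T (g u)) := by
  refine isClosed_of_closure_subset fun y hy => ?_
  obtain ⟨z, hz, hzy⟩ := mem_closure_iff_seq_limit.1 hy
  choose u hu using hz
  simp only at hu
  obtain ⟨r, hr, C, hC⟩ := exists_norm_le_of_dist_le hε hT hg hloc y
  have hC0 : ∀ᶠ n in atTop, ‖g (u n)‖ ≤ C := by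
    filter_upwards [hzy.eventually (Metric.closedBall_mem_nhds y hr)] with n hn
    apply hC
    rw [hu, ← dist_eq_norm]
    exact hn
  obtain ⟨a, ha⟩ : ∃ a, Tendsto u atTop (𝓝 a) := by
    have hd := hzy.dist_prod_self
    refine exists_tendsto_of_dist_le
      (b := fun p => dist (z p.1) (z p.2) + √(2 * C / ε * dist (z p.1) (z p.2))) ?_ ?_
    · simpa using hd.add (Real.continuous_sqrt.continuousAt.tendsto.comp (hd.const_mul (2 * C / ε)))
    · filter_upwards [hC0.prod_mk hC0] with p hp
      have h1 := mul_norm_sq_le_inner hT (hg (u p.1) (u p.2))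
      have e : u p.1 - u p.2 + T (g (u p.1) - g (u p.2)) = z p.1 - z p.2 := by
        rw [← hu, ← hu, map_sub]; abel
      rw [e] at h1
      have h2 : ⟪g (u p.1) - g (u p.2), z p.1 - z p.2⟫_ℝ ≤ 2 * C * dist (z p.1) (z p.2) := by
        rw [dist_eq_norm]
        refine (real_inner_le_norm _ _).trans ?_
        gcongr
        linarith [norm_sub_le (g (u p.1)) (g (u p.2)), hp.1, hp.2]
      have h3 : ‖T (g (u p.1) - g (u p.2))‖ ≤ √(2 * C / ε * dist (z p.1) (z p.2)) := by
        apply Real.le_sqrt_of_sq_le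
        rw [div_mul_eq_mul_div, le_div_iff₀ hε]
        linarith
      calc dist (u p.1) (u p.2) = ‖(z p.1 - z p.2) - T (g (u p.1) - g (u p.2))‖ := by
            rw [← e, dist_eq_norm]; simp
        _ ≤ ‖z p.1 - z p.2‖ + ‖T (g (u p.1) - g (u p.2))‖ := norm_sub_le _ _
        _ ≤ _ := by rw [dist_eq_norm (z p.1)]; gcongr; rwa [← dist_eq_norm]
  refine ⟨a, tendsto_nhds_unique (f := z) ?_ hzy⟩
  have : Tendsto (fun n => u n + T (g (u n))) atTop (𝓝 (a + T (g a))) :=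
    ha.add ((T.continuous.comp hc).continuousAt.tendsto.comp ha)
  simpa only [hu] using this

/-! ### The continuous Newton flow -/

section Flow

theorem IsC2Loc.locally_norm_le {g : H → H} (hg : IsC2Loc g) (y : H) :
    ∃ R : ℝ, 0 < R ∧ ∃ m : ℝ, ∀ u ∈ Metric.closedBall y R, ‖g u‖ ≤ m := by
  obtain ⟨R, hR, m, _, _, h⟩ := hg.locally_bounded y
  exact ⟨R, hR, m, fun u hu => (h u hu).1⟩

theorem hasFDerivAt_add_comp (T : H →L[ℝ] H) {g : H → H} (hg : Differentiable ℝ g) (u : H) :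
    HasFDerivAt (fun u => u + T (g u)) (newtonOp T g u) u :=
  (hasFDerivAt_id u).add (T.hasFDerivAt.comp u (hg u).hasFDerivAt)

theorem continuous_newtonOp (T : H →L[ℝ] H) {g : H → H} (hg : Continuous (fderiv ℝ g)) :
    Continuous (newtonOp T g) :=
  continuous_const.add (continuous_const.clm_comp hg)

variable [CompleteSpace H]

theorem isInvertible_newtonOp {T : H →L[ℝ] H} {ε : ℝ} (hε : 0 < ε)
    (hT : ∀ x, ε * ‖T x‖ ^ 2 ≤ ⟪T x, x⟫_ℝ) (hTinj : Function.Injective T) {g : H → H}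
    (hmono : ∀ u h : H, 0 ≤ ⟪fderiv ℝ g u h, h⟫_ℝ) (u : H) : (newtonOp T g u).IsInvertible :=
  isInvertible_id_add_comp hε hT hTinj (hmono u)

/-- The map `u ↦ u + T g(u)` is a homeomorphism of `H` onto itself: it is injective and open, and
its range is closed. -/
theorem exists_homeomorph_add_comp {T : H →L[ℝ] H} {ε : ℝ} (hε : 0 < ε)
    (hT : ∀ x, ε * ‖T x‖ ^ 2 ≤ ⟪T x, x⟫_ℝ) (hTinj : Function.Injective T) {g : H → H}
    (hg : IsC2Loc g) (hmono : ∀ u h : H, 0 ≤ ⟪fderiv ℝ g u h, h⟫_ℝ) :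
    ∃ e : H ≃ₜ H, ∀ u, e u = u + T (g u) := by
  have hgm := inner_sub_sub_nonneg hg.differentiable hmono
  have hcont : Continuous fun u => u + T (g u) :=
    continuous_id.add (T.continuous.comp hg.differentiable.continuous)
  have hopen : IsOpenMap fun u => u + T (g u) := by
    refine IsOpenMap.of_nhds_le fun u => ?_
    obtain ⟨N, hN⟩ := isInvertible_newtonOp hε hT hTinj hmono u
    have hs : HasStrictFDerivAt (fun u => u + T (g u)) (newtonOp T g u) u :=
      hasStrictFDerivAt_of_hasFDerivAt_of_continuousAt
        (Eventually.of_forall (hasFDerivAt_add_comp T hg.differentiable))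
        (continuous_newtonOp T hg.differentiable_fderiv.continuous).continuousAt
    rw [← hN] at hs
    exact hs.map_nhds_eq_of_equiv.ge
  have hinj := injective_add_comp hε hT hgm
  have hsurj : Function.Surjective fun u => u + T (g u) := by
    rw [← range_eq_univ]
    exact IsClopen.eq_univ ⟨isClosed_range_add_comp hε hT hg.differentiable.continuous hgm
      hg.locally_norm_le, hopen.isOpen_range⟩ (range_nonempty _)
  exact ⟨(Equiv.ofBijective _ ⟨hinj, hsurj⟩).toHomeomorphOfContinuousOpen hcont hopen,
    fun _ => rfl⟩

/-- The continuous Newton flow is global, unique, and converges to the zero of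
`u ↦ u + T g(u)`: along the flow `u + T g(u)` decays exactly like `exp (-t)`. -/
theorem exists_globalSolution_tendsto {T : H →L[ℝ] H} {ε : ℝ} (hε : 0 < ε)
    (hT : ∀ x, ε * ‖T x‖ ^ 2 ≤ ⟪T x, x⟫_ℝ) (hTinj : Function.Injective T) {g : H → H}
    (hg : IsC2Loc g) (hmono : ∀ u h : H, 0 ≤ ⟪fderiv ℝ g u h, h⟫_ℝ) (u₀ : H) :
    ∃ v : H, v + T (g v) = 0 ∧ ∃ u : ℝ → H, IsGlobalSolution (field T g) u₀ u ∧
      (∀ u' : ℝ → H, IsGlobalSolution (field T g) u₀ u' → EqOn u' u (Ici 0)) ∧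
      Tendsto u atTop (𝓝 v) := by
  obtain ⟨e, he⟩ := exists_homeomorph_add_comp hε hT hTinj hg hmono
  have hinv := isInvertible_newtonOp hε hT hTinj hmono
  have hF := hasFDerivAt_add_comp T hg.differentiable
  have hes : ∀ y, e.symm y + T (g (e.symm y)) = y := fun y => by
    rw [← he, e.apply_symm_apply]
  have hexp : ∀ t : ℝ, HasDerivAt (fun t : ℝ => Real.exp (-t) • e u₀)
      (-(Real.exp (-t) • e u₀)) t := by
    intro t
    simpa using ((hasDerivAt_neg t).exp).smul_const (e u₀)
  refine ⟨e.symm 0, hes 0, fun t => e.symm (Real.exp (-t) • e u₀), ⟨by simp, fun t _ => ?_⟩, ?_, ?_⟩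
  · obtain ⟨N, hN⟩ := hinv (e.symm (Real.exp (-t) • e u₀))
    have h1 := hF (e.symm (Real.exp (-t) • e u₀))
    rw [← hN] at h1
    have h2 : HasFDerivAt e.symm (N.symm : H →L[ℝ] H) (Real.exp (-t) • e u₀) :=
      HasFDerivAt.of_local_left_inverse e.symm.continuous.continuousAt h1
        (Eventually.of_forall hes)
    have h3 := h2.comp_hasDerivAt t (hexp t)
    have h4 : field T g (e.symm (Real.exp (-t) • e u₀)) = N.symm (-(Real.exp (-t) • e u₀)) := by
      rw [field, hes, ← hN, ContinuousLinearMap.inverse_equiv, map_neg]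
      rfl
    rw [h4]
    exact h3.hasDerivWithinAt
  · rintro u' ⟨hu0, hu'⟩ t ht
    -- For any solution, `exp s • F (u' s)` is constant; injectivity of `F` then determines `u'`.
    have hconst : ∀ s ∈ Ici (0 : ℝ),
        HasDerivWithinAt (fun s => Real.exp s • (u' s + T (g (u' s)))) 0 (Ici 0) s := by
      intro s hs
      have h1 := (hF (u' s)).comp_hasDerivWithinAt s (hu' s hs)
      have h2 : newtonOp T g (u' s) (field T g (u' s)) = -(u' s + T (g (u' s))) := by
        rw [field, map_neg, (hinv (u' s)).self_apply_inverse]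
      rw [h2] at h1
      convert (Real.hasDerivAt_exp s).hasDerivWithinAt.smul h1 using 1
      · rfl
      · simp [← smul_add]
    have h0 : ‖Real.exp t • (u' t + T (g (u' t))) - Real.exp 0 • (u' 0 + T (g (u' 0)))‖
        ≤ 0 * ‖t - 0‖ :=
      Convex.norm_image_sub_le_of_norm_hasDerivWithin_le hconst (fun _ _ => by simp)
        (convex_Ici 0) self_mem_Ici ht
    rw [zero_mul, norm_le_zero_iff, sub_eq_zero, Real.exp_zero, one_smul, hu0, ← he, ← he] at h0
    change u' t = e.symm (Real.exp (-t) • e u₀)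
    rw [e.eq_symm_apply, ← h0, smul_smul, ← Real.exp_add]
    simp
  · refine (e.symm.continuous.tendsto 0).comp ?_
    have := (Real.tendsto_exp_neg_atTop_nhds_zero).smul_const (e u₀)
    simpa using this

end Flow

/-! ### The shifted operator -/

theorem _root_.LinearPMap.IsClosed.exists_apply_eq_of_tendsto {ι : Type*} {l : Filter ι} [l.NeBot]
    {L : H →ₗ.[ℝ] H} (hL : L.IsClosed) {x z : ι → H} {a b : H}
    (hx : ∀ᶠ i in l, ∃ h : x i ∈ L.domain, L ⟨x i, h⟩ = z i)
    (hxa : Tendsto x l (𝓝 a)) (hzb : Tendsto z l (𝓝 b)) : ∃ h : a ∈ L.domain, L ⟨a, h⟩ = b := by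
  have hmem : (a, b) ∈ (L.graph : Set (H × H)) := by
    refine hL.mem_of_tendsto (hxa.prodMk_nhds hzb) ?_
    filter_upwards [hx] with i hi
    obtain ⟨h, hi⟩ := hi
    exact L.mem_graph_iff.2 ⟨⟨x i, h⟩, rfl, hi⟩
  obtain ⟨⟨y, hy⟩, h1, h2⟩ := L.mem_graph_iff.1 hmem
  subst h1
  exact ⟨hy, h2⟩

theorem shift_apply (L : H →ₗ.[ℝ] H) (ε : ℝ) {x : H} (hx : x ∈ L.domain) :
    shift L ε ⟨x, hx⟩ = ε • x + L ⟨x, hx⟩ := rfl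

theorem mul_norm_sq_le_inner_shift {L : H →ₗ.[ℝ] H}
    (hnonneg : ∀ x : L.domain, 0 ≤ ⟪L x, (x : H)⟫_ℝ) (ε : ℝ) (x : (shift L ε).domain) :
    ε * ‖(x : H)‖ ^ 2 ≤ ⟪shift L ε x, (x : H)⟫_ℝ := by
  obtain ⟨x, hx⟩ := x
  change x ∈ L.domain at hx
  rw [shift_apply L ε hx, inner_add_left, inner_smul_left, real_inner_self_eq_norm_sq]
  simpa using hnonneg ⟨x, hx⟩

theorem mul_norm_le_norm_shift {L : H →ₗ.[ℝ] H}
    (hnonneg : ∀ x : L.domain, 0 ≤ ⟪L x, (x : H)⟫_ℝ) (ε : ℝ) (x : (shift L ε).domain) :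
    ε * ‖(x : H)‖ ≤ ‖shift L ε x‖ := by
  rcases eq_or_lt_of_le (norm_nonneg (x : H)) with h0 | h0
  · rw [← h0, mul_zero]; positivity
  · refine le_of_mul_le_mul_right ?_ h0
    calc ε * ‖(x : H)‖ * ‖(x : H)‖ = ε * ‖(x : H)‖ ^ 2 := by ring
      _ ≤ _ := mul_norm_sq_le_inner_shift hnonneg ε x
      _ ≤ _ := real_inner_le_norm _ _

section Complete

variable [CompleteSpace H]

/-- The range is closed by the lower bound `ε ‖x‖`. A vector `y` orthogonal to it lies in the domain
of `L* = L` with `L y = -ε y`, which `L ≥ 0` allows only for `y = 0`. -/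
theorem surjective_shift {L : H →ₗ.[ℝ] H} (hself : IsSelfAdjoint L)
    (hnonneg : ∀ x : L.domain, 0 ≤ ⟪L x, (x : H)⟫_ℝ) {ε : ℝ} (hε : 0 < ε) :
    Function.Surjective (shift L ε) := by
  have hclosed : IsClosed ((shift L ε).toFun.range : Set H) := by
    refine isClosed_of_closure_subset fun y hy => ?_
    obtain ⟨z, hz, hzy⟩ := mem_closure_iff_seq_limit.1 hy
    choose x hx using hz
    have hx' : ∀ n, shift L ε (x n) = z n := hx
    obtain ⟨a, ha⟩ : ∃ a, Tendsto (fun n => (x n : H)) atTop (𝓝 a) := by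
      refine exists_tendsto_of_dist_le (b := fun p => ε⁻¹ * dist (z p.1) (z p.2)) ?_ ?_
      · simpa using hzy.dist_prod_self.const_mul ε⁻¹
      · refine Eventually.of_forall fun p => ?_
        have h := mul_norm_le_norm_shift hnonneg ε (x p.1 - x p.2)
        rw [LinearPMap.map_sub, hx', hx', ← dist_eq_norm, Submodule.coe_sub, ← dist_eq_norm] at h
        rw [inv_mul_eq_div, le_div_iff₀ hε]
        linarith
    obtain ⟨h, hLa⟩ := hself.isClosed.exists_apply_eq_of_tendsto
      (z := fun n => z n - ε • (x n : H)) (Eventually.of_forall fun n => ⟨(x n).2, by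
        rw [← hx' n]; exact (add_sub_cancel_left _ _).symm⟩) ha (hzy.sub (ha.const_smul ε))
    exact ⟨⟨a, h⟩, by
      change shift L ε ⟨a, h⟩ = y
      rw [shift_apply, hLa]; abel⟩
  have hrange : (shift L ε).toFun.range = ⊤ := by
    rw [← hclosed.submodule_topologicalClosure_eq, Submodule.topologicalClosure_eq_top_iff,
      Submodule.eq_bot_iff]
    intro y hy
    have hy' : ∀ x : L.domain, ⟪-(ε • y), (x : H)⟫_ℝ = ⟪y, L x⟫_ℝ := by
      intro x
      have h : ⟪ε • (x : H) + L x, y⟫_ℝ = 0 := (Submodule.mem_orthogonal _ _).1 hy _ ⟨x, rfl⟩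
      rw [inner_add_left, real_inner_smul_left] at h
      rw [inner_neg_left, real_inner_smul_left, real_inner_comm, real_inner_comm (L x)]
      linarith
    have hadj : L.adjoint = L := LinearPMap.isSelfAdjoint_def.1 hself
    have hmem : y ∈ L.adjoint.domain := LinearPMap.mem_adjoint_domain_of_exists y ⟨_, hy'⟩
    have happ := LinearPMap.adjoint_apply_eq hself.dense_domain ⟨y, hmem⟩ hy'
    -- A variable `A` lets `L.adjoint = L` be substituted although the membership proof depends on
    -- the operator.
    have hnn : ∀ A : H →ₗ.[ℝ] H, A = L → ∀ h : y ∈ A.domain, 0 ≤ ⟪A ⟨y, h⟩, y⟫_ℝ := by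
      rintro A rfl h
      exact hnonneg ⟨y, h⟩
    have h0 := hnn _ hadj hmem
    rw [happ, inner_neg_left, real_inner_smul_left, real_inner_self_eq_norm_sq] at h0
    have : ‖y‖ ^ 2 ≤ 0 := by nlinarith [sq_nonneg ‖y‖]
    simpa using le_antisymm this (sq_nonneg _)
  exact LinearMap.range_eq_top.1 hrange

theorem exists_isBoundedInverse_shift {L : H →ₗ.[ℝ] H} (hself : IsSelfAdjoint L)
    (hnonneg : ∀ x : L.domain, 0 ≤ ⟪L x, (x : H)⟫_ℝ) {ε : ℝ} (hε : 0 < ε) :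
    ∃ T : H →L[ℝ] H, IsBoundedInverse (shift L ε) T := by
  have hinj : Function.Injective (shift L ε).toFun := by
    rw [injective_iff_map_eq_zero]
    intro x hx
    have h := mul_norm_le_norm_shift hnonneg ε x
    rw [show shift L ε x = 0 from hx, norm_zero] at h
    have : ‖(x : H)‖ ≤ 0 := by nlinarith [norm_nonneg (x : H)]
    exact Subtype.ext (norm_le_zero_iff.1 this)
  let A := LinearEquiv.ofBijective (shift L ε).toFun ⟨hinj, surjective_shift hself hnonneg hε⟩
  have hA : ∀ y, shift L ε (A.symm y) = y := fun y => A.apply_symm_apply y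
  refine ⟨LinearMap.mkContinuous ((shift L ε).domain.subtype ∘ₗ A.symm.toLinearMap) ε⁻¹
    fun y => ?_, fun y => ⟨(A.symm y).2, hA y⟩, fun x => congrArg Subtype.val (A.symm_apply_apply x)⟩
  have h := mul_norm_le_norm_shift hnonneg ε (A.symm y)
  rw [hA] at h
  rw [inv_mul_eq_div, le_div_iff₀ hε, mul_comm]
  exact h

end Complete

theorem IsBoundedInverse.mul_norm_sq_le_inner {L : H →ₗ.[ℝ] H}
    (hnonneg : ∀ x : L.domain, 0 ≤ ⟪L x, (x : H)⟫_ℝ) {ε : ℝ} {T : H →L[ℝ] H}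
    (hT : IsBoundedInverse (shift L ε) T) (y : H) : ε * ‖T y‖ ^ 2 ≤ ⟪T y, y⟫_ℝ := by
  obtain ⟨h, hy⟩ := hT.1 y
  have := mul_norm_sq_le_inner_shift hnonneg ε ⟨T y, h⟩
  rwa [hy, real_inner_comm] at this

theorem IsBoundedInverse.injective {A : H →ₗ.[ℝ] H} {T : H →L[ℝ] H} (hT : IsBoundedInverse A T) :
    Function.Injective T := by
  intro a b hab
  obtain ⟨ha, ha'⟩ := hT.1 a
  obtain ⟨hb, hb'⟩ := hT.1 b
  rw [← ha', ← hb']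
  congr 2

theorem IsBoundedInverse.mem_solutionSet {A : H →ₗ.[ℝ] H} {T : H →L[ℝ] H}
    (hT : IsBoundedInverse A T) {g : H → H} {v : H} (hv : v + T (g v) = 0) :
    v ∈ solutionSet A g := by
  have e : v = T (-g v) := by rw [map_neg]; exact eq_neg_of_add_eq_zero_left hv
  obtain ⟨h, h'⟩ := hT.1 (-g v)
  have hv' : v ∈ A.domain := by rw [e]; exact h
  refine ⟨hv', ?_⟩
  have : A ⟨v, hv'⟩ = -g v := by
    rw [← h']
    congr 2
  rw [this, neg_add_cancel]

/-! ### The solution set and the limit `ε → 0` -/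

theorem isClosed_solutionSet {L : H →ₗ.[ℝ] H} (hL : L.IsClosed) {g : H → H} (hg : Continuous g) :
    IsClosed (solutionSet L g) := by
  refine isClosed_of_closure_subset fun v hv => ?_
  obtain ⟨x, hx, hxv⟩ := mem_closure_iff_seq_limit.1 hv
  obtain ⟨h, h'⟩ := hL.exists_apply_eq_of_tendsto (z := fun n => -g (x n))
    (Eventually.of_forall fun n => (hx n).imp fun _ h => eq_neg_of_add_eq_zero_left h) hxv
    ((hg.tendsto v).comp hxv).neg
  exact ⟨h, by rw [h', neg_add_cancel]⟩

/-- For monotone `L` and `g`, a point `z` of the domain and a solution `a`, the vector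
`L z + g z` makes an acute angle with `z - a`. -/
theorem inner_nonneg_of_mem_solutionSet {L : H →ₗ.[ℝ] H}
    (hnonneg : ∀ x : L.domain, 0 ≤ ⟪L x, (x : H)⟫_ℝ) {g : H → H}
    (hg : ∀ a b, 0 ≤ ⟪g a - g b, a - b⟫_ℝ) {a : H} (ha : a ∈ solutionSet L g) (z : L.domain) :
    0 ≤ ⟪L z + g z, (z : H) - a⟫_ℝ := by
  obtain ⟨ha, ha'⟩ := ha
  have h1 := hnonneg (z - ⟨a, ha⟩)
  have h2 := hg z a
  rw [LinearPMap.map_sub, Submodule.coe_sub] at h1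
  have e : L z + g z = (L z - L ⟨a, ha⟩) + (g z - g a) := by
    rw [← sub_zero (L z + g z), ← ha']; abel
  rw [e, inner_add_left]
  linarith

/-- Minty's trick: the acute-angle inequality is affine in the solution, so it passes to a convex
combination `c`. Testing at `c + r • h`, dividing by `r` and letting `r → 0⁺`, then using `±h` and
density, recovers the equation at `c`. -/
theorem convex_solutionSet {L : H →ₗ.[ℝ] H} (hdense : Dense (L.domain : Set H))
    (hnonneg : ∀ x : L.domain, 0 ≤ ⟪L x, (x : H)⟫_ℝ) {g : H → H} (hc : Continuous g)
    (hg : ∀ a b, 0 ≤ ⟪g a - g b, a - b⟫_ℝ) : Convex ℝ (solutionSet L g) := by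
  intro a ha b hb s t hs ht hst
  have hcd : s • a + t • b ∈ L.domain :=
    L.domain.add_mem (L.domain.smul_mem s ha.1) (L.domain.smul_mem t hb.1)
  set c := s • a + t • b with hcdef
  have hacute : ∀ z : L.domain, 0 ≤ ⟪L z + g z, (z : H) - c⟫_ℝ := by
    intro z
    have e : (z : H) - c = s • ((z : H) - a) + t • ((z : H) - b) := by
      rw [hcdef, smul_sub, smul_sub]
      nth_rewrite 1 [← one_smul ℝ (z : H)]
      rw [← hst, add_smul]
      abel
    rw [e, inner_add_right, inner_smul_right, inner_smul_right]
    exact add_nonneg (mul_nonneg hs (inner_nonneg_of_mem_solutionSet hnonneg hg ha z))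
      (mul_nonneg ht (inner_nonneg_of_mem_solutionSet hnonneg hg hb z))
  have hinner : ∀ h : L.domain, 0 ≤ ⟪L ⟨c, hcd⟩ + g c, (h : H)⟫_ℝ := by
    intro h
    have hlim : Tendsto (fun r : ℝ => ⟪L ⟨c, hcd⟩ + r • L h + g (c + r • (h : H)), (h : H)⟫_ℝ)
        (𝓝[>] 0) (𝓝 ⟪L ⟨c, hcd⟩ + g c, (h : H)⟫_ℝ) := by
      have hcont : Continuous
          fun r : ℝ => ⟪L ⟨c, hcd⟩ + r • L h + g (c + r • (h : H)), (h : H)⟫_ℝ := by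
        fun_prop
      simpa using (hcont.tendsto 0).mono_left nhdsWithin_le_nhds
    refine ge_of_tendsto hlim ?_
    filter_upwards [self_mem_nhdsWithin] with r hr
    have h1 := hacute (⟨c, hcd⟩ + r • h)
    rw [LinearPMap.map_add, LinearPMap.map_smul, Submodule.coe_add, Submodule.coe_smul,
      add_sub_cancel_left, inner_smul_right] at h1
    exact nonneg_of_mul_nonneg_right h1 hr
  refine ⟨hcd, hdense.eq_zero_of_inner_left ℝ fun h hh => le_antisymm ?_ (hinner ⟨h, hh⟩)⟩
  have := hinner (-⟨h, hh⟩)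
  rw [Submodule.coe_neg, inner_neg_right] at this
  linarith

theorem IsMinNormSolution.unique {L : H →ₗ.[ℝ] H} {g : H → H}
    (hconv : Convex ℝ (solutionSet L g)) {v w : H} (hv : IsMinNormSolution L g v)
    (hw : IsMinNormSolution L g w) : w = v := by
  have hnorm : ‖w‖ = ‖v‖ := le_antisymm (hw.2 v hv.1) (hv.2 w hw.1)
  have hmid : (1 / 2 : ℝ) • v + (1 / 2 : ℝ) • w ∈ solutionSet L g :=
    hconv hv.1 hw.1 (by norm_num) (by norm_num) (by norm_num)
  have h1 := hv.2 _ hmid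
  rw [← smul_add, norm_smul, Real.norm_of_nonneg (by norm_num : (0 : ℝ) ≤ 1 / 2)] at h1
  have h2 := parallelogram_law_with_norm ℝ v w
  have h3 : ‖v - w‖ * ‖v - w‖ ≤ 0 := by
    rw [hnorm] at h2
    nlinarith [norm_nonneg v, norm_nonneg (v + w)]
  have h4 : ‖v - w‖ = 0 := by nlinarith [norm_nonneg (v - w)]
  exact (sub_eq_zero.1 (norm_eq_zero.1 h4)).symm

/-- Solutions of the regularized equations for two parameters: monotonicity of `L` and `g`. -/
theorem inner_smul_sub_smul_nonpos {L : H →ₗ.[ℝ] H}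
    (hnonneg : ∀ x : L.domain, 0 ≤ ⟪L x, (x : H)⟫_ℝ) {g : H → H}
    (hg : ∀ a b, 0 ≤ ⟪g a - g b, a - b⟫_ℝ) {ε δ : ℝ} {a b : H}
    (ha : a ∈ solutionSet (shift L ε) g) (hb : b ∈ solutionSet (shift L δ) g) :
    ⟪ε • a - δ • b, a - b⟫_ℝ ≤ 0 := by
  obtain ⟨ha, ha'⟩ := ha
  obtain ⟨hb, hb'⟩ := hb
  change a ∈ L.domain at ha
  change b ∈ L.domain at hb
  rw [shift_apply L ε ha] at ha'
  rw [shift_apply L δ hb] at hb'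
  have h1 := hnonneg (⟨a, ha⟩ - ⟨b, hb⟩)
  have h2 := hg a b
  rw [LinearPMap.map_sub, Submodule.coe_sub] at h1
  have e : ε • a - δ • b = -((L ⟨a, ha⟩ - L ⟨b, hb⟩) + (g a - g b)) := by
    rw [eq_neg_iff_add_eq_zero, ← sub_zero (0 : H)]
    nth_rewrite 1 [← ha']
    rw [← hb']
    abel
  rw [e, inner_neg_left, inner_add_left]
  linarith

theorem norm_le_of_mem_solutionSet {L : H →ₗ.[ℝ] H}
    (hnonneg : ∀ x : L.domain, 0 ≤ ⟪L x, (x : H)⟫_ℝ) {g : H → H}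
    (hg : ∀ a b, 0 ≤ ⟪g a - g b, a - b⟫_ℝ) {ε : ℝ} (hε : 0 < ε) {a z : H}
    (ha : a ∈ solutionSet (shift L ε) g) (hz : z ∈ solutionSet L g) : ‖a‖ ≤ ‖z‖ := by
  -- With parameter `0` for `z`, the two-parameter inequality becomes `ε ⟪a, a - z⟫ ≤ 0`.
  have hz' : z ∈ solutionSet (shift L 0) g := by
    obtain ⟨h, h'⟩ := hz
    exact ⟨h, by rw [shift_apply L 0 h, zero_smul, zero_add, h']⟩
  have h := inner_smul_sub_smul_nonpos hnonneg hg ha hz'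
  rw [zero_smul, sub_zero, real_inner_smul_left, inner_sub_right, real_inner_self_eq_norm_sq] at h
  have h1 : ‖a‖ ^ 2 ≤ ‖a‖ * ‖z‖ := by
    have : ‖a‖ ^ 2 - ⟪a, z⟫_ℝ ≤ 0 := by
      by_contra hcon
      exact absurd h (not_le.2 (mul_pos hε (not_le.1 hcon)))
    linarith [real_inner_le_norm a z]
  nlinarith [norm_nonneg a, norm_nonneg z]

/-- Polarization turns the two-parameter inequality into `(ε + δ) ‖a - b‖² ≤ (δ - ε) (‖a‖² - ‖b‖²)`,
and `δ - ε ≤ δ + ε`. -/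
theorem dist_sq_le_of_mem_solutionSet {L : H →ₗ.[ℝ] H}
    (hnonneg : ∀ x : L.domain, 0 ≤ ⟪L x, (x : H)⟫_ℝ) {g : H → H}
    (hg : ∀ a b, 0 ≤ ⟪g a - g b, a - b⟫_ℝ) {ε δ : ℝ} (hε : 0 < ε) (hδ : ε < δ) {a b : H}
    (ha : a ∈ solutionSet (shift L ε) g) (hb : b ∈ solutionSet (shift L δ) g) :
    dist a b ^ 2 ≤ ‖a‖ ^ 2 - ‖b‖ ^ 2 := by
  have h := inner_smul_sub_smul_nonpos hnonneg hg ha hb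
  have e : 2 * ⟪ε • a - δ • b, a - b⟫_ℝ
      = (ε + δ) * ‖a - b‖ ^ 2 - (δ - ε) * (‖a‖ ^ 2 - ‖b‖ ^ 2) := by
    rw [norm_sub_sq_real, inner_sub_left, inner_sub_right, inner_sub_right]
    simp only [real_inner_smul_left, real_inner_self_eq_norm_sq, real_inner_comm a b]
    ring
  rw [dist_eq_norm]
  have h1 : (ε + δ) * ‖a - b‖ ^ 2 ≤ (δ - ε) * (‖a‖ ^ 2 - ‖b‖ ^ 2) := by linarith
  have h2 : 0 ≤ ‖a‖ ^ 2 - ‖b‖ ^ 2 :=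
    nonneg_of_mul_nonneg_right
      ((mul_nonneg (by linarith) (sq_nonneg _)).trans h1) (sub_pos.2 hδ)
  have h3 : (ε + δ) * ‖a - b‖ ^ 2 ≤ (ε + δ) * (‖a‖ ^ 2 - ‖b‖ ^ 2) :=
    h1.trans (mul_le_mul_of_nonneg_right (by linarith) h2)
  exact le_of_mul_le_mul_left h3 (by linarith)

/-- The solutions of the regularized equations converge to a solution of minimal norm. -/
theorem exists_isMinNormSolution_tendsto [CompleteSpace H] {L : H →ₗ.[ℝ] H} (hL : L.IsClosed)
    (hnonneg : ∀ x : L.domain, 0 ≤ ⟪L x, (x : H)⟫_ℝ) {g : H → H} (hc : Continuous g)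
    (hg : ∀ a b, 0 ≤ ⟪g a - g b, a - b⟫_ℝ) (hsolv : (solutionSet L g).Nonempty) {w : ℝ → H}
    (hw : ∀ ε, 0 < ε → w ε ∈ solutionSet (shift L ε) g) :
    ∃ v, IsMinNormSolution L g v ∧ Tendsto w (𝓝[>] 0) (𝓝 v) := by
  have hdist : ∀ ε δ, 0 < ε → ε ≤ δ → dist (w ε) (w δ) ^ 2 ≤ ‖w ε‖ ^ 2 - ‖w δ‖ ^ 2 := by
    intro ε δ hε hδ
    rcases hδ.eq_or_lt with rfl | hlt
    · simp
    · exact dist_sq_le_of_mem_solutionSet hnonneg hg hε hlt (hw ε hε) (hw δ (hε.trans hlt))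
  have hanti : AntitoneOn (fun ε => ‖w ε‖ ^ 2) (Ioi 0) := fun ε hε δ _ hεδ => by
    have := hdist ε δ hε hεδ
    have := sq_nonneg (dist (w ε) (w δ))
    simp only
    linarith
  have hbdd : BddAbove ((fun ε => ‖w ε‖ ^ 2) '' Ioi 0) := by
    obtain ⟨z, hz⟩ := hsolv
    refine ⟨‖z‖ ^ 2, ?_⟩
    rintro _ ⟨ε, hε, rfl⟩
    have := norm_le_of_mem_solutionSet hnonneg hg hε (hw ε hε) hz
    simp only
    gcongr
  have hlim := hanti.tendsto_nhdsGT hbdd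
  have hpos : ∀ᶠ ε : ℝ in 𝓝[>] 0, 0 < ε := self_mem_nhdsWithin
  obtain ⟨v, hv⟩ : ∃ v, Tendsto w (𝓝[>] 0) (𝓝 v) := by
    refine exists_tendsto_of_dist_le
      (b := fun p => √(dist (‖w p.1‖ ^ 2) (‖w p.2‖ ^ 2))) ?_ ?_
    · simpa [Function.comp_def] using
        Real.continuous_sqrt.continuousAt.tendsto.comp hlim.dist_prod_self
    · filter_upwards [hpos.prod_mk hpos] with p hp
      apply Real.le_sqrt_of_sq_le
      rw [Real.dist_eq]
      rcases le_total p.1 p.2 with hle | hle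
      · exact (hdist _ _ hp.1 hle).trans (le_abs_self _)
      · rw [dist_comm, abs_sub_comm]
        exact (hdist _ _ hp.2 hle).trans (le_abs_self _)
  refine ⟨v, ⟨?_, fun z hz => ?_⟩, hv⟩
  · have hid : Tendsto (fun ε : ℝ => ε) (𝓝[>] 0) (𝓝 0) := tendsto_id.mono_left nhdsWithin_le_nhds
    obtain ⟨h, h'⟩ := hL.exists_apply_eq_of_tendsto (z := fun ε => -g (w ε) - ε • w ε)
      (by
        filter_upwards [hpos] with ε hε
        obtain ⟨h, h'⟩ := hw ε hε
        change w ε ∈ L.domain at h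
        refine ⟨h, ?_⟩
        rw [shift_apply L ε h] at h'
        rw [eq_sub_iff_add_eq, eq_neg_iff_add_eq_zero, ← h']
        abel) hv
      (((hc.tendsto v).comp hv).neg.sub (hid.smul hv))
    exact ⟨h, by rw [h', zero_smul, sub_zero, neg_add_cancel]⟩
  · refine le_of_tendsto hv.norm ?_
    filter_upwards [hpos] with ε hε
    exact norm_le_of_mem_solutionSet hnonneg hg hε (hw ε hε) hz

end DSM

/-! ### Main theorem. -/

theorem theorem1p2 {H : Type*} [NormedAddCommGroup H] [InnerProductSpace ℝ H] [CompleteSpace H]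
    (L : H →ₗ.[ℝ] H) (hdense : Dense (L.domain : Set H)) (hself : IsSelfAdjoint L)
    (hnonneg : ∀ x : L.domain, 0 ≤ ⟪L x, (x : H)⟫_ℝ)
    (g : H → H) (hg : DSM.IsC2Loc g)
    (hmono : ∀ u h : H, 0 ≤ ⟪fderiv ℝ g u h, h⟫_ℝ)
    (hsolv : (DSM.solutionSet L g).Nonempty) (u₀ : H) :
    IsClosed (DSM.solutionSet L g) ∧ Convex ℝ (DSM.solutionSet L g) ∧
    ∃ (T : ℝ → H →L[ℝ] H) (vε : ℝ → H) (v : H),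
      (∀ ε : ℝ, 0 < ε →
        DSM.IsBoundedInverse (DSM.shift L ε) (T ε) ∧
        (∀ u : H, (DSM.newtonOp (T ε) g u).IsInvertible) ∧
        (∃ u : ℝ → H,
          DSM.IsGlobalSolution (DSM.field (T ε) g) u₀ u ∧
          (∀ u' : ℝ → H, DSM.IsGlobalSolution (DSM.field (T ε) g) u₀ u' →
            EqOn u' u (Ici 0)) ∧
          Tendsto u atTop (𝓝 (vε ε))) ∧
        vε ε ∈ DSM.solutionSet (DSM.shift L ε) g) ∧
      DSM.IsMinNormSolution L g v ∧
      (∀ w : H, DSM.IsMinNormSolution L g w → w = v) ∧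
      Tendsto vε (𝓝[>] 0) (𝓝 v) := by
  have hgm := DSM.inner_sub_sub_nonneg hg.differentiable hmono
  have hgc := hg.differentiable.continuous
  have hconv := DSM.convex_solutionSet hdense hnonneg hgc hgm
  -- Values chosen at `ε ≤ 0` are arbitrary; the filter `𝓝[>] 0` does not see them.
  choose! T hT using fun (ε : ℝ) (hε : 0 < ε) =>
    DSM.exists_isBoundedInverse_shift hself hnonneg hε
  have hTc := fun (ε : ℝ) (hε : 0 < ε) => (hT ε hε).mul_norm_sq_le_inner hnonneg
  have hTi := fun (ε : ℝ) (hε : 0 < ε) => (hT ε hε).injective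
  choose! vε hvε hflow using fun (ε : ℝ) (hε : 0 < ε) =>
    DSM.exists_globalSolution_tendsto hε (hTc ε hε) (hTi ε hε) hg hmono u₀
  have hsol := fun (ε : ℝ) (hε : 0 < ε) => (hT ε hε).mem_solutionSet (hvε ε hε)
  obtain ⟨v, hv, hlim⟩ := DSM.exists_isMinNormSolution_tendsto hself.isClosed hnonneg hgc hgm
    hsolv hsol
  exact ⟨DSM.isClosed_solutionSet hself.isClosed hgc, hconv, T, vε, v,
    fun ε hε => ⟨hT ε hε, DSM.isInvertible_newtonOp hε (hTc ε hε) (hTi ε hε) hmono,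
      hflow ε hε, hsol ε hε⟩, hv, fun _ hw => hv.unique hconv hw, hlim⟩
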